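/- Let $F$ be a field of characteristic not $2$, let $V$ be an $F$-vector space (of any dimension) with a symmetric bilinear form $B$, and let $\mathrm{Cl}(V)$ be its Clifford algebra, the quotient of the tensor algebra by the relations $uv+vu=2B(u,v)$. Let $\mathrm{Cl}^k(V)$ denote the preimage of the $k$-th exterior power of $V$ under the canonical linear isomorphism from $\mathrm{Cl}(V)$ to the exterior algebra of $V$, and let $x\times y=\tfrac12(xy-yx)$. The space of bivectors $\mathrm{Cl}^2(V)$ is a Lie algebra under $\times$. Let $e_0\in V$ be a nonzero vector with $B(e_0,v)=0$ for all $v\in V$, and let $W\subseteq V$ be a linear complement of $Fe_0$. Equip $W$ with the restriction of $B$ and $V/Fe_0$ with the form induced by $B$. For any such quadratic space $U$ (here $U=W$ or $U=V/Fe_0$), regard $U$ as an abelian Lie algebra and let $\mathrm{Cl}^2(U)\ltimes_\tau U$ be the semidirect sum for the Lie algebra homomorphism $\tau:\mathrm{Cl}^2(U)\to\mathrm{Der}(U)$, $\tau(b)(u)=b\times u$ (the commutator being taken in $\mathrm{Cl}(U)$, where it lies in $U$). Theorem. 1. The homomorphism $\mathrm{Cl}^2(W)\to\mathrm{Cl}^2(V)$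 induced by the inclusion is injective, $We_0=\{we_0 : w\in W\}$ is an abelian ideal of the Lie algebra $\mathrm{Cl}^2(V)$, and $\mathrm{Cl}^2(V)=\mathrm{Cl}^2(W)\oplus We_0$ as vector spaces. That is, $\mathrm{Cl}^2(V)$ is the internal semidirect sum $\mathrm{Cl}^2(W)\ltimes We_0$. 2. There is an isomorphism of Lie algebras $\mathrm{Cl}^2(V)\cong\mathrm{Cl}^2(W)\ltimes_\tau W$ sending $b\mapsto(b,0)$ for $b\in\mathrm{Cl}^2(W)$ and $we_0\mapsto(0,w)$ for $w\in W$. 3. There is an isomorphism of Lie algebras $\mathrm{Cl}^2(V)\cong\mathrm{Cl}^2(V/Fe_0)\ltimes_{\tau'}V/Fe_0$, where $\tau'$ is the map $\tau$ for $U=V/Fe_0$, sending $b\mapsto(\mathrm{Cl}^2(\pi)(b),0)$ for $b\in\mathrm{Cl}^2(W)$ and $we_0\mapsto(0,\pi(w))$ for $w\in W$, where $\pi:V\to V/Fe_0$ is the canonical projection and $\mathrm{Cl}^2(\pi)$ the homomorphism it induces. -/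

import Mathlib

noncomputable section

namespace PGA

open CliffordAlgebra

section Grade

variable {F : Type*} [Field F] [Invertible (2 : F)] {V : Type*} [AddCommGroup V] [Module F V]

/-- The grade-`k` part `Cl^k` of the Clifford algebra: the preimage of the `k`-th exterior power
under the canonical linear isomorphism from the Clifford algebra to the exterior algebra. -/
def grade (Q : QuadraticForm F V) (k : ℕ) : Submodule F (CliffordAlgebra Q) :=
  (⋀[F]^k V).comap (equivExterior Q : CliffordAlgebra Q →ₗ[F] ExteriorAlgebra F V)

/-- The commutator product `x × y = (1/2) (x y - y x)`. -/
def comm {A : Type*} [Ring A] [Algebra F A] (x y : A) : A := (⅟2 : F) • (x * y - y * x)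

variable (Q : QuadraticForm F V)

lemma equivExterior_ι (v : V) : equivExterior Q (ι Q v) = ExteriorAlgebra.ι F v :=
  changeForm_ι (changeForm.associated_neg_proof (Q := Q)) v

lemma equivExterior_symm_ι (v : V) : (equivExterior Q).symm (ExteriorAlgebra.ι F v) = ι Q v := by
  rw [LinearEquiv.symm_apply_eq, equivExterior_ι]

lemma equivExterior_comm (u v : V) :
    equivExterior Q (comm (F := F) (ι Q u) (ι Q v)) =
      ExteriorAlgebra.ι F u * ExteriorAlgebra.ι F v := by
  have h : ∀ a b : V, equivExterior Q (ι Q a * ι Q b) =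
      ExteriorAlgebra.ι F a * ExteriorAlgebra.ι F b -
        algebraMap F _ ((QuadraticMap.associated (R := F) (M := V) (-Q)) a b) :=
    fun a b => changeForm_ι_mul_ι (changeForm.associated_neg_proof (Q := Q)) a b
  have hs : (QuadraticMap.associated (R := F) (M := V) (-Q)) v u =
      (QuadraticMap.associated (R := F) (M := V) (-Q)) u v :=
    QuadraticMap.associated_isSymm F (-Q) v u
  have hanti : ExteriorAlgebra.ι F v * ExteriorAlgebra.ι F u =
      -(ExteriorAlgebra.ι F u * ExteriorAlgebra.ι F v) :=
    eq_neg_of_add_eq_zero_right (ExteriorAlgebra.ι_add_mul_swap u v)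
  rw [comm, map_smul, map_sub, h, h, hs, hanti, sub_sub_sub_cancel_right, sub_neg_eq_add,
    ← two_smul F, smul_smul, invOf_mul_self, one_smul]

/-- Bivectors are the linear span of the elements `u × v` for vectors `u`, `v`. -/
lemma grade_two_eq_span :
    grade Q 2 = Submodule.span F {x | ∃ u v : V, x = comm (F := F) (ι Q u) (ι Q v)} := by
  have h : grade Q 2 = (⋀[F]^2 V).map ((equivExterior Q).symm :
      ExteriorAlgebra F V →ₗ[F] CliffordAlgebra Q) := by
    rw [grade]
    exact (Submodule.map_equiv_eq_comap_symm (equivExterior Q).symm _).symm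
  rw [h, ← ExteriorAlgebra.ιMulti_span_fixedDegree, Submodule.map_span]
  congr 1
  ext x
  constructor
  · rintro ⟨_, ⟨a, rfl⟩, rfl⟩
    refine ⟨a 0, a 1, ?_⟩
    rw [LinearEquiv.coe_coe, LinearEquiv.symm_apply_eq, equivExterior_comm]
    simp [ExteriorAlgebra.ιMulti_apply, Matrix.vecTail]
  · rintro ⟨u, v, rfl⟩
    refine ⟨_, ⟨![u, v], rfl⟩, ?_⟩
    rw [LinearEquiv.coe_coe, LinearEquiv.symm_apply_eq, equivExterior_comm]
    simp [ExteriorAlgebra.ιMulti_apply]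

lemma comm_ι_mem (u v : V) : comm (F := F) (ι Q u) (ι Q v) ∈ grade Q 2 := by
  rw [grade_two_eq_span]
  exact Submodule.subset_span ⟨u, v, rfl⟩

/-- `x × y` as a bilinear map. -/
def commL (A : Type*) [Ring A] [Algebra F A] : A →ₗ[F] A →ₗ[F] A :=
  LinearMap.mk₂ F (comm (F := F))
    (fun x y z => by simp only [comm, ← smul_add]; congr 1; noncomm_ring)
    (fun c x y => by
      simp only [comm, smul_mul_assoc, mul_smul_comm, ← smul_sub]; rw [smul_comm])
    (fun x y z => by simp only [comm, ← smul_add]; congr 1; noncomm_ring)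
    (fun c x y => by
      simp only [comm, smul_mul_assoc, mul_smul_comm, ← smul_sub]; rw [smul_comm])

lemma commL_apply {A : Type*} [Ring A] [Algebra F A] (x y : A) :
    commL (F := F) A x y = comm (F := F) x y := rfl

lemma comm_self {A : Type*} [Ring A] [Algebra F A] (x : A) : comm (F := F) x x = 0 := by
  simp [comm]

lemma comm_leibniz {A : Type*} [Ring A] [Algebra F A] (x y z : A) :
    comm (F := F) x (comm (F := F) y z) =
      comm (F := F) (comm (F := F) x y) z + comm (F := F) y (comm (F := F) x z) := by
  simp only [comm, mul_smul_comm, smul_mul_assoc, ← smul_sub, ← smul_add]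
  congr 2
  noncomm_ring

lemma comm_comm_ι (u v w : V) :
    comm (F := F) (comm (F := F) (ι Q u) (ι Q v)) (ι Q w) =
      ι Q ((⅟2 * QuadraticMap.polar Q v w) • u - (⅟2 * QuadraticMap.polar Q u w) • v) := by
  have key : ∀ a b c : V, ι Q a * ι Q b * ι Q c - ι Q c * (ι Q a * ι Q b) =
      QuadraticMap.polar Q b c • ι Q a - QuadraticMap.polar Q a c • ι Q b := by
    intro a b c
    have h1 := ι_mul_ι_add_swap (Q := Q) b c
    have h2 := ι_mul_ι_add_swap (Q := Q) a c
    have e : ι Q a * ι Q b * ι Q c - ι Q c * (ι Q a * ι Q b) =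
        ι Q a * (ι Q b * ι Q c + ι Q c * ι Q b) - (ι Q a * ι Q c + ι Q c * ι Q a) * ι Q b := by
      noncomm_ring
    rw [e, h1, h2, ← Algebra.commutes, ← Algebra.smul_def, ← Algebra.smul_def]
  have e : comm (F := F) (comm (F := F) (ι Q u) (ι Q v)) (ι Q w) =
      (⅟2 : F) • (⅟2 : F) • ((ι Q u * ι Q v * ι Q w - ι Q w * (ι Q u * ι Q v)) -
        (ι Q v * ι Q u * ι Q w - ι Q w * (ι Q v * ι Q u))) := by
    simp only [comm, mul_smul_comm, smul_mul_assoc, ← smul_sub]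
    congr 2
    noncomm_ring
  have e2 : ∀ p q : CliffordAlgebra Q, p - q - (q - p) = (2 : F) • (p - q) := by
    intro p q
    rw [two_smul]
    abel
  rw [e, key, key, e2, smul_smul (⅟2 : F) (2 : F), invOf_mul_self, one_smul, smul_sub, smul_smul,
    smul_smul, map_sub, map_smul, map_smul]

/-- For a bivector `b` and a vector `w`, the commutator `b × w` is a vector. -/
lemma comm_ι_mem_range {b : CliffordAlgebra Q} (hb : b ∈ grade Q 2) (w : V) :
    comm (F := F) b (ι Q w) ∈ LinearMap.range (ι Q) := by
  rw [grade_two_eq_span] at hb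
  induction hb using Submodule.span_induction with
  | mem x hx =>
    obtain ⟨u, v, rfl⟩ := hx
    rw [comm_comm_ι]
    exact ⟨_, rfl⟩
  | zero => rw [← commL_apply, map_zero]; exact zero_mem _
  | add x y _ _ hx hy =>
    rw [← commL_apply, map_add]; exact add_mem hx hy
  | smul c x _ hx =>
    rw [← commL_apply, map_smul]; exact Submodule.smul_mem _ c hx

lemma comm_mem {x y : CliffordAlgebra Q} (hx : x ∈ grade Q 2) (hy : y ∈ grade Q 2) :
    comm (F := F) x y ∈ grade Q 2 := by
  rw [grade_two_eq_span] at hy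
  induction hy using Submodule.span_induction with
  | mem y hy =>
    obtain ⟨u, v, rfl⟩ := hy
    obtain ⟨u', hu⟩ := comm_ι_mem_range Q hx u
    obtain ⟨v', hv⟩ := comm_ι_mem_range Q hx v
    rw [comm_leibniz, ← hu, ← hv]
    exact add_mem (comm_ι_mem Q _ _) (comm_ι_mem Q _ _)
  | zero => rw [← commL_apply, map_zero]; exact zero_mem _
  | add y z _ _ h1 h2 => rw [← commL_apply, map_add]; exact add_mem h1 h2
  | smul c y _ h => rw [← commL_apply, map_smul]; exact Submodule.smul_mem _ c h

/-- The space of bivectors. -/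
abbrev Bivector : Type _ := grade Q 2

/-- Bivectors form a Lie algebra under the commutator product. -/
instance : Bracket (Bivector Q) (Bivector Q) where
  bracket x y := ⟨comm (F := F) x.1 y.1, comm_mem Q x.2 y.2⟩

lemma coe_lie (x y : Bivector Q) :
    (⁅x, y⁆ : Bivector Q).1 = comm (F := F) x.1 y.1 := rfl

instance : LieRing (Bivector Q) where
  add_lie x y z := Subtype.ext (LinearMap.map_add₂ (commL (F := F) _) x.1 y.1 z.1)
  lie_add x y z := Subtype.ext (map_add (commL (F := F) _ x.1) y.1 z.1)
  lie_self x := Subtype.ext (comm_self x.1)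
  leibniz_lie x y z := Subtype.ext (comm_leibniz x.1 y.1 z.1)

instance : LieAlgebra F (Bivector Q) where
  lie_smul c x y := Subtype.ext (map_smul (commL (F := F) _ x.1) c y.1)

end Grade

section Abelian

/-- A vector space regarded as an abelian Lie algebra (all brackets are zero). -/
def AbelianLie (M : Type*) : Type _ := M

variable {F : Type*} [Field F] {M : Type*} [AddCommGroup M] [Module F M]

instance : AddCommGroup (AbelianLie M) := inferInstanceAs (AddCommGroup M)

instance : Module F (AbelianLie M) := inferInstanceAs (Module F M)

instance : LieRing (AbelianLie M) where
  bracket _ _ := 0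
  add_lie _ _ _ := (add_zero _).symm
  lie_add _ _ _ := (add_zero _).symm
  lie_self _ := rfl
  leibniz_lie _ _ _ := (add_zero _).symm

instance : LieAlgebra F (AbelianLie M) where
  lie_smul c _ _ := (smul_zero c).symm

/-- A vector as an element of the abelian Lie algebra. -/
def AbelianLie.of (F : Type*) [Field F] {M : Type*} [AddCommGroup M] [Module F M] :
    M ≃ₗ[F] AbelianLie M := LinearEquiv.refl F M

lemma AbelianLie.lie_eq_zero (x y : AbelianLie M) : ⁅x, y⁆ = 0 := rfl

end Abelian

section Action

variable {F : Type*} [Field F] [Invertible (2 : F)] {V : Type*} [AddCommGroup V] [Module F V]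
variable (Q : QuadraticForm F V)

/-- The left inverse of `ι : V → Cl(V)` that reads off the grade-one part. -/
def vectorPart : CliffordAlgebra Q →ₗ[F] V :=
  ExteriorAlgebra.ιInv ∘ₗ (equivExterior Q : CliffordAlgebra Q →ₗ[F] ExteriorAlgebra F V)

lemma vectorPart_ι (v : V) : vectorPart Q (ι Q v) = v := by
  simp only [vectorPart, LinearMap.comp_apply, LinearEquiv.coe_coe, equivExterior_ι]
  exact ExteriorAlgebra.ι_leftInverse v

/-- `b × w` as a vector. -/
def actVec (b : Bivector Q) : V →ₗ[F] V :=
  vectorPart Q ∘ₗ commL (F := F) _ b.1 ∘ₗ ι Q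

/-- The vector `actVec Q b w` is indeed the commutator `b × w`. -/
lemma ι_actVec (b : Bivector Q) (w : V) :
    ι Q (actVec Q b w) = comm (F := F) b.1 (ι Q w) := by
  obtain ⟨u, hu⟩ := comm_ι_mem_range Q b.2 w
  simp only [actVec, LinearMap.comp_apply, commL_apply]
  rw [← hu, vectorPart_ι]

lemma actVec_lie (b c : Bivector Q) (w : V) :
    actVec Q ⁅b, c⁆ w = actVec Q b (actVec Q c w) - actVec Q c (actVec Q b w) := by
  have inj : Function.Injective (ι Q) := Function.LeftInverse.injective (vectorPart_ι Q)
  apply inj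
  rw [map_sub, ι_actVec, ι_actVec, ι_actVec, ι_actVec, ι_actVec, coe_lie]
  exact eq_sub_of_add_eq (comm_leibniz b.1 c.1 (ι Q w)).symm

/-- The action `τ(b) : w ↦ b × w` of bivectors by derivations of the abelian Lie algebra
of vectors. -/
def tau : Bivector Q →ₗ⁅F⁆ LieDerivation F (AbelianLie V) (AbelianLie V) where
  toFun b :=
    { toLinearMap := (AbelianLie.of F).conj (actVec Q b)
      leibniz' := fun x y => by simp only [AbelianLie.lie_eq_zero, map_zero, sub_zero] }
  map_add' b c := by
    ext w
    change vectorPart Q (commL (F := F) _ (b.1 + c.1) (ι Q w)) =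
      vectorPart Q (commL (F := F) _ b.1 (ι Q w)) + vectorPart Q (commL (F := F) _ c.1 (ι Q w))
    rw [LinearMap.map_add₂, map_add]
  map_smul' r b := by
    ext w
    change vectorPart Q (commL (F := F) _ (r • b.1) (ι Q w)) =
      r • vectorPart Q (commL (F := F) _ b.1 (ι Q w))
    rw [LinearMap.map_smul₂, map_smul]
  map_lie' := by
    intro b c
    ext w
    rw [LieDerivation.lie_apply]
    exact actVec_lie Q b c w

lemma tau_apply (b : Bivector Q) (w : V) :
    tau Q b (AbelianLie.of F w) = AbelianLie.of F (actVec Q b w) := rfl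

end Action

section Functor

variable {F : Type*} [Field F] [Invertible (2 : F)]
variable {V₁ : Type*} [AddCommGroup V₁] [Module F V₁] {V₂ : Type*} [AddCommGroup V₂] [Module F V₂]
variable {Q₁ : QuadraticForm F V₁} {Q₂ : QuadraticForm F V₂}

lemma map_comm {A C : Type*} [Ring A] [Algebra F A] [Ring C] [Algebra F C] (f : A →ₐ[F] C)
    (x y : A) : f (comm (F := F) x y) = comm (F := F) (f x) (f y) := by
  simp [comm]

lemma map_mem_grade_two (f : Q₁ →qᵢ Q₂) {x : CliffordAlgebra Q₁} (hx : x ∈ grade Q₁ 2) :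
    CliffordAlgebra.map f x ∈ grade Q₂ 2 := by
  rw [grade_two_eq_span] at hx
  induction hx using Submodule.span_induction with
  | mem x hx =>
    obtain ⟨u, v, rfl⟩ := hx
    rw [map_comm, map_apply_ι, map_apply_ι]
    exact comm_ι_mem Q₂ _ _
  | zero => rw [map_zero]; exact zero_mem _
  | add x y _ _ hx hy => rw [map_add]; exact add_mem hx hy
  | smul c x _ hx => rw [map_smul]; exact Submodule.smul_mem _ c hx

/-- The Lie algebra homomorphism `Cl²(f) : Cl²(V₁) → Cl²(V₂)` that the Clifford extension of an
isometry `f` restricts to. -/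
def bivectorMap (f : Q₁ →qᵢ Q₂) : Bivector Q₁ →ₗ⁅F⁆ Bivector Q₂ where
  toFun x := ⟨CliffordAlgebra.map f x.1, map_mem_grade_two f x.2⟩
  map_add' x y := Subtype.ext (map_add _ x.1 y.1)
  map_smul' c x := Subtype.ext (map_smul _ c x.1)
  map_lie' := Subtype.ext (map_comm _ _ _)

end Functor

section Spaces

variable {F : Type*} [Field F] {V : Type*} [AddCommGroup V] [Module F V]

/-- The quadratic form `v ↦ B(v, v)`; its Clifford algebra is the quotient of the tensor algebra
by the relations `u v + v u = 2 B(u, v)` when `B` is symmetric and `2` is invertible. -/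
abbrev quad (B : LinearMap.BilinForm F V) : QuadraticForm F V := B.toQuadraticMap

/-- The isometric inclusion of a subspace. -/
def inclusion (B : LinearMap.BilinForm F V) (W : Submodule F V) :
    quad (B.restrict W) →qᵢ quad B where
  toLinearMap := W.subtype
  map_app' _ := rfl

/-- The bilinear form induced on the quotient by a radical subspace. -/
def quotientForm (B : LinearMap.BilinForm F V) (hB : B.IsSymm) (U : Submodule F V)
    (hU : U ≤ LinearMap.ker B) : LinearMap.BilinForm F (V ⧸ U) :=
  hB.isRefl.liftQ₂ B U hU

lemma quotientForm_mk (B : LinearMap.BilinForm F V) (hB : B.IsSymm) (U : Submodule F V)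
    (hU : U ≤ LinearMap.ker B) (u v : V) :
    quotientForm B hB U hU (U.mkQ u) (U.mkQ v) = B u v := rfl

/-- The canonical projection onto the quotient by a radical subspace, an isometry. -/
def projection (B : LinearMap.BilinForm F V) (hB : B.IsSymm) (U : Submodule F V)
    (hU : U ≤ LinearMap.ker B) : quad B →qᵢ quad (quotientForm B hB U hU) where
  toLinearMap := U.mkQ
  map_app' _ := rfl

end Spaces

end PGA

end

noncomputable section

namespace PGA

open CliffordAlgebra LieAlgebra

/-! ### Products of vectors with a radical vector -/

section Radical

variable {F : Type*} [Field F] [Invertible (2 : F)] {V : Type*} [AddCommGroup V] [Module F V]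
variable {Q : QuadraticForm F V} {e : V}

/-! For `e` in the radical, `v e = v × e`, `e² = 0`, and every bivector commutes with `e`. Since `b
× ·` is a derivation, `b × (v e) = (b × v) e`: the map `v ↦ v e` carries the action on vectors to
the bracket (`lie_mulRadical`). Its image is an abelian ideal, and its kernel is `F e` when `e ≠ 0`.
Now let `s : U → V` be an isometry with a left inverse `r` killing `e`, and let `s(U) + F e = V`.
Then `(u, b) ↦ Cl²(s)(b) + s(u) e` is a Lie homomorphism. It is injective because `Cl²(r)` separates
the summands, and surjective by expanding `v × w` along `V = s(U) + F e`. Taking `s` to be the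
inclusion of `W`, or the section `V/Fe₀ ≅ W ⊆ V`, gives both isomorphisms. -/

lemma quadraticForm_eq_zero_of_polar (he : ∀ v, QuadraticMap.polar Q v e = 0) : Q e = 0 := by
  have h := he e
  rw [QuadraticMap.polar_self, two_smul, ← two_mul] at h
  exact (mul_eq_zero.mp h).resolve_left (Invertible.ne_zero 2)

/-- A vector anticommutes with a vector of the radical. -/
lemma comm_ι_radical (he : ∀ v, QuadraticMap.polar Q v e = 0) (v : V) :
    comm (F := F) (ι Q v) (ι Q e) = ι Q v * ι Q e := by
  have h := ι_mul_ι_add_swap (Q := Q) v e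
  rw [he, map_zero] at h
  rw [comm, eq_neg_of_add_eq_zero_right h, sub_neg_eq_add, ← two_smul F, smul_smul,
    invOf_mul_self, one_smul]

/-- Right multiplication of vectors by a vector of the radical, with values in the bivectors. -/
def mulRadical (he : ∀ v, QuadraticMap.polar Q v e = 0) : V →ₗ[F] Bivector Q :=
  (LinearMap.mulRight F (ι Q e) ∘ₗ ι Q).codRestrict (grade Q 2) fun v => by
    rw [LinearMap.comp_apply, LinearMap.mulRight_apply, ← comm_ι_radical he]
    exact comm_ι_mem Q v e

lemma coe_mulRadical (he : ∀ v, QuadraticMap.polar Q v e = 0) (v : V) :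
    (mulRadical he v).1 = ι Q v * ι Q e := rfl

lemma mulRadical_self (he : ∀ v, QuadraticMap.polar Q v e = 0) : mulRadical he e = 0 := by
  apply Subtype.ext
  rw [coe_mulRadical, ι_sq_scalar, quadraticForm_eq_zero_of_polar he, map_zero]
  rfl

/-- Bivectors commute with the vectors of the radical. -/
lemma comm_bivector_radical (he : ∀ v, QuadraticMap.polar Q v e = 0) (b : Bivector Q) :
    comm (F := F) b.1 (ι Q e) = 0 := by
  obtain ⟨b, hb⟩ := b
  change commL (F := F) _ b (ι Q e) = 0
  rw [grade_two_eq_span] at hb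
  rw [← LinearMap.flip_apply]
  refine (Submodule.span_le (p := LinearMap.ker ((commL (F := F) _).flip (ι Q e)))).mpr ?_ hb
  rintro _ ⟨u, v, rfl⟩
  -- Each term of `(u × v) × e` has a factor `polar Q · e`.
  rw [SetLike.mem_coe, LinearMap.mem_ker, LinearMap.flip_apply, commL_apply, comm_comm_ι, he, he]
  simp

/-- Leibniz rule on `v × e`: the term containing `b × e` vanishes. -/
lemma lie_mulRadical (he : ∀ v, QuadraticMap.polar Q v e = 0) (b : Bivector Q) (v : V) :
    ⁅b, mulRadical he v⁆ = mulRadical he (actVec Q b v) := by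
  apply Subtype.ext
  rw [coe_lie, coe_mulRadical, coe_mulRadical, ← comm_ι_radical he, ← comm_ι_radical he,
    comm_leibniz, comm_bivector_radical he, ι_actVec, ← commL_apply (ι Q v), map_zero, add_zero]

/-- `(v e) × w` is a multiple of `e`, and `e² = 0`. -/
lemma mulRadical_lie_mulRadical (he : ∀ v, QuadraticMap.polar Q v e = 0) (v w : V) :
    ⁅mulRadical he v, mulRadical he w⁆ = 0 := by
  have h : actVec Q (mulRadical he v) w = (-(⅟2 * QuadraticMap.polar Q v w)) • e := by
    apply Function.LeftInverse.injective (vectorPart_ι Q)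
    rw [ι_actVec, coe_mulRadical, ← comm_ι_radical he, comm_comm_ι, QuadraticMap.polar_comm Q e,
      he, mul_zero, zero_smul, zero_sub, neg_smul]
  rw [lie_mulRadical, h, map_smul, mulRadical_self, smul_zero]

/-- Contracting `v e` with a functional `d` such that `d e = 1` gives `d(v) e - v`, so `v e = 0`
forces `v = d(v) e`. -/
lemma mem_span_of_mulRadical_eq_zero (he : ∀ v, QuadraticMap.polar Q v e = 0) (he₀ : e ≠ 0)
    {v : V} (hv : mulRadical he v = 0) : v ∈ Submodule.span F {e} := by
  obtain ⟨d, hd⟩ := Module.Projective.exists_dual_eq_one F he₀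
  have h : contractLeft d (ι Q v * ι Q e) = 0 := by
    rw [← coe_mulRadical he, hv]
    exact map_zero _
  rw [contractLeft_ι_mul, contractLeft_ι, hd, map_one, mul_one, ← map_smul, ← map_sub] at h
  have h' := congrArg (vectorPart Q) h
  rw [vectorPart_ι, map_zero] at h'
  rw [← sub_eq_zero.mp h']
  exact Submodule.smul_mem _ _ (Submodule.mem_span_singleton_self e)

/-- The abelian ideal of the bivectors `v e`, for `e` in the radical. -/
def radicalIdeal (he : ∀ v, QuadraticMap.polar Q v e = 0) : LieIdeal F (Bivector Q) where
  toSubmodule := LinearMap.range (mulRadical he)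
  lie_mem := by
    rintro x _ ⟨v, rfl⟩
    exact ⟨_, (lie_mulRadical he x v).symm⟩

lemma isLieAbelian_radicalIdeal (he : ∀ v, QuadraticMap.polar Q v e = 0) :
    IsLieAbelian (radicalIdeal he) where
  trivial := by
    rintro ⟨_, v, rfl⟩ ⟨_, w, rfl⟩
    exact Subtype.ext (mulRadical_lie_mulRadical he v w)

end Radical

/-! ### Semidirect splitting from an isometry with a retraction -/

section Splitting

variable {F : Type*} [Field F] [Invertible (2 : F)]
variable {V : Type*} [AddCommGroup V] [Module F V] {U : Type*} [AddCommGroup U] [Module F U]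
variable {Q : QuadraticForm F V} {Q' : QuadraticForm F U} {e : V}

/-- Algebra homomorphisms preserve commutators; this matches `tau` with the bracket in
`semiDirectHom`. -/
lemma actVec_bivectorMap (s : Q' →qᵢ Q) (b : Bivector Q') (u : U) :
    actVec Q (bivectorMap s b) (s u) = s (actVec Q' b u) := by
  apply Function.LeftInverse.injective (vectorPart_ι Q)
  rw [ι_actVec, ← map_apply_ι, ← map_apply_ι, ι_actVec, map_comm]
  rfl

lemma bivectorMap_comp {U' : Type*} [AddCommGroup U'] [Module F U'] {Q'' : QuadraticForm F U'}
    (f : Q' →qᵢ Q) (g : Q'' →qᵢ Q') (b : Bivector Q'') :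
    bivectorMap f (bivectorMap g b) = bivectorMap (f.comp g) b :=
  Subtype.ext (DFunLike.congr_fun (map_comp_map f g) b.1)

lemma bivectorMap_leftInverse {s : Q' →qᵢ Q} {r : Q →qᵢ Q'} (h : Function.LeftInverse r s) :
    Function.LeftInverse (bivectorMap r) (bivectorMap s) :=
  fun b => Subtype.ext (leftInverse_map_of_leftInverse s r h b.1)

/-- The Lie algebra homomorphism `(u, b) ↦ Cl²(s)(b) + s(u) e`, for an isometry `s` and a vector
`e` of the radical. -/
def semiDirectHom (he : ∀ v, QuadraticMap.polar Q v e = 0) (s : Q' →qᵢ Q) :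
    (AbelianLie U ⋊⁅tau Q'⁆ Bivector Q') →ₗ⁅F⁆ Bivector Q where
  toFun x := bivectorMap s x.right + mulRadical he (s ((AbelianLie.of F).symm x.left))
  map_add' x y := by
    rw [SemiDirectSum.add_eq_mk]
    simp only [map_add]
    abel
  map_smul' c x := by
    rw [SemiDirectSum.smul_eq_mk]
    simp only [map_smul, smul_add, RingHom.id_apply]
  map_lie' := by
    rintro ⟨u, b⟩ ⟨w, c⟩
    obtain ⟨u, rfl⟩ := (AbelianLie.of F).surjective u
    obtain ⟨w, rfl⟩ := (AbelianLie.of F).surjective w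
    rw [SemiDirectSum.lie_eq_mk]
    simp only [AbelianLie.lie_eq_zero, zero_add, tau_apply, map_sub, LinearEquiv.symm_apply_apply,
      add_lie, lie_add, LieHom.map_lie]
    -- Only the two mixed brackets involve the ideal nontrivially; one has the bivector on the
    -- right, hence the sign from `lie_skew`.
    rw [mulRadical_lie_mulRadical, lie_mulRadical, actVec_bivectorMap,
      ← lie_skew (mulRadical he (s u)), lie_mulRadical, actVec_bivectorMap]
    abel

lemma semiDirectHom_inr (he : ∀ v, QuadraticMap.polar Q v e = 0) (s : Q' →qᵢ Q)
    (b : Bivector Q') : semiDirectHom he s (SemiDirectSum.inr _ b) = bivectorMap s b := by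
  change bivectorMap s b + mulRadical he (s 0) = _
  rw [map_zero, map_zero, add_zero]

lemma semiDirectHom_inl (he : ∀ v, QuadraticMap.polar Q v e = 0) (s : Q' →qᵢ Q) (u : U) :
    semiDirectHom he s (SemiDirectSum.inl _ (AbelianLie.of F u)) = mulRadical he (s u) := by
  change bivectorMap s 0 + mulRadical he (s u) = _
  rw [map_zero, zero_add]

/-- If an isometry `r` kills `e`, then `bivectorMap r` kills the bivectors `v e`. -/
lemma bivectorMap_mulRadical (he : ∀ v, QuadraticMap.polar Q v e = 0) {r : Q →qᵢ Q'}
    (hr : r e = 0) (v : V) : bivectorMap r (mulRadical he v) = 0 := by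
  apply Subtype.ext
  change CliffordAlgebra.map r (ι Q v * ι Q e) = 0
  rw [map_mul, map_apply_ι, map_apply_ι, hr, map_zero, mul_zero]

/-- Applying `Cl²(r)` isolates `b`; then `s(u) e = 0` puts `s(u)` in `F e`, which `r` kills. -/
lemma semiDirectHom_injective (he : ∀ v, QuadraticMap.polar Q v e = 0) (he₀ : e ≠ 0)
    {s : Q' →qᵢ Q} {r : Q →qᵢ Q'} (h : Function.LeftInverse r s) (hr : r e = 0) :
    Function.Injective (semiDirectHom he s) := by
  rw [injective_iff_map_eq_zero]
  rintro ⟨u, b⟩ hx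
  obtain ⟨u, rfl⟩ := (AbelianLie.of F).surjective u
  change bivectorMap s b + mulRadical he (s u) = 0 at hx
  have hb : b = 0 := by
    have := congrArg (bivectorMap r) hx
    rwa [map_add, bivectorMap_mulRadical he hr, bivectorMap_leftInverse h, add_zero,
      map_zero] at this
  rw [hb, map_zero, zero_add] at hx
  obtain ⟨c, hc⟩ := Submodule.mem_span_singleton.mp (mem_span_of_mulRadical_eq_zero he he₀ hx)
  have hu : u = 0 := by rw [← h u, ← hc, map_smul, hr, smul_zero]
  rw [hb, hu, map_zero]
  rfl

lemma semiDirectHom_surjective (he : ∀ v, QuadraticMap.polar Q v e = 0) {s : Q' →qᵢ Q}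
    (hs : ∀ v, ∃ u, v - s u ∈ Submodule.span F {e}) :
    Function.Surjective (semiDirectHom he s) := by
  -- The spanning set lives in the Clifford algebra, so the range is pushed forward there.
  suffices h : grade Q 2 ≤
      (LinearMap.range (semiDirectHom he s).toLinearMap).map (grade Q 2).subtype by
    rintro ⟨x, hx⟩
    obtain ⟨_, ⟨y, rfl⟩, hy⟩ := h hx
    exact ⟨y, Subtype.ext hy⟩
  conv_lhs => rw [grade_two_eq_span]
  rw [Submodule.span_le]
  rintro _ ⟨v, w, rfl⟩
  obtain ⟨v', hv⟩ := hs v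
  obtain ⟨w', hw⟩ := hs w
  obtain ⟨c, hc⟩ := Submodule.mem_span_singleton.mp hv
  obtain ⟨d, hd⟩ := Submodule.mem_span_singleton.mp hw
  rw [eq_sub_iff_add_eq'] at hc hd
  -- With `s` suppressed, `(v' + c e) × (w' + d e) = v' × w' + (d v' - c w') e`.
  refine ⟨_, ⟨⟨AbelianLie.of F (d • v' - c • w'), ⟨_, comm_ι_mem Q' v' w'⟩⟩, rfl⟩, ?_⟩
  change CliffordAlgebra.map s (comm (F := F) (ι Q' v') (ι Q' w')) +
    ι Q (s (d • v' - c • w')) * ι Q e = _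
  have hswap : comm (F := F) (ι Q e) (ι Q (s w')) = -(ι Q (s w') * ι Q e) := by
    rw [← comm_ι_radical he, comm, comm, ← smul_neg, neg_sub]
  rw [map_comm, map_apply_ι, map_apply_ι, ← hc, ← hd]
  simp only [← commL_apply, map_add, map_smul, map_sub, LinearMap.add_apply, LinearMap.smul_apply]
  simp only [commL_apply, comm_ι_radical he, hswap, sub_mul, smul_mul_assoc]
  rw [← coe_mulRadical he e, mulRadical_self he]
  simp
  abel

/-- If the isometry `s` has a left inverse `r` with `r e = 0` and its image together with `F e`
spans, then the bivectors are the semidirect sum of `Cl²(U)` and `U`. -/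
def semiDirectEquiv (he : ∀ v, QuadraticMap.polar Q v e = 0) (he₀ : e ≠ 0)
    {s : Q' →qᵢ Q} {r : Q →qᵢ Q'} (h : Function.LeftInverse r s) (hr : r e = 0)
    (hs : ∀ v, ∃ u, v - s u ∈ Submodule.span F {e}) :
    Bivector Q ≃ₗ⁅F⁆ (AbelianLie U ⋊⁅tau Q'⁆ Bivector Q') :=
  (LieEquiv.ofBijective (semiDirectHom he s)
    ⟨semiDirectHom_injective he he₀ h hr, semiDirectHom_surjective he hs⟩).symm

lemma semiDirectEquiv_bivectorMap (he : ∀ v, QuadraticMap.polar Q v e = 0) (he₀ : e ≠ 0)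
    {s : Q' →qᵢ Q} {r : Q →qᵢ Q'} (h : Function.LeftInverse r s) (hr : r e = 0)
    (hs : ∀ v, ∃ u, v - s u ∈ Submodule.span F {e}) (b : Bivector Q') :
    semiDirectEquiv he he₀ h hr hs (bivectorMap s b) = SemiDirectSum.inr _ b := by
  rw [← semiDirectHom_inr he s b]
  exact LieEquiv.symm_apply_apply _ _

lemma semiDirectEquiv_mulRadical (he : ∀ v, QuadraticMap.polar Q v e = 0) (he₀ : e ≠ 0)
    {s : Q' →qᵢ Q} {r : Q →qᵢ Q'} (h : Function.LeftInverse r s) (hr : r e = 0)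
    (hs : ∀ v, ∃ u, v - s u ∈ Submodule.span F {e}) (u : U) :
    semiDirectEquiv he he₀ h hr hs (mulRadical he (s u)) =
      SemiDirectSum.inl _ (AbelianLie.of F u) := by
  rw [← semiDirectHom_inl he s u]
  exact LieEquiv.symm_apply_apply _ _

/-- `Cl²(r)` kills the ideal and is injective on the subalgebra, so they meet in zero;
`semiDirectHom_surjective` gives the sum. -/
lemma isCompl_range_bivectorMap_radicalIdeal (he : ∀ v, QuadraticMap.polar Q v e = 0)
    {s : Q' →qᵢ Q} {r : Q →qᵢ Q'} (h : Function.LeftInverse r s) (hr : r e = 0)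
    (hs : ∀ v, ∃ u, v - s u ∈ Submodule.span F {e}) :
    IsCompl (bivectorMap s).range.toSubmodule (radicalIdeal he).toSubmodule := by
  refine ⟨Submodule.disjoint_def.mpr ?_, codisjoint_iff.mpr (eq_top_iff.mpr fun x _ => ?_)⟩
  · rintro _ ⟨b, rfl⟩ ⟨v, hv⟩
    change mulRadical he v = bivectorMap s b at hv
    change bivectorMap s b = 0
    rw [← bivectorMap_leftInverse h b, ← hv, bivectorMap_mulRadical he hr, map_zero]
  · obtain ⟨y, rfl⟩ := semiDirectHom_surjective he hs x
    exact Submodule.add_mem_sup ⟨y.right, rfl⟩ ⟨_, rfl⟩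

/-- Because `e² = 0`, the ideal `V e` already equals `W e` for a complement `W` of `F e`. -/
lemma mulRadical_eq_of_sub_mem (he : ∀ v, QuadraticMap.polar Q v e = 0) {v w : V}
    (h : v - w ∈ Submodule.span F {e}) : mulRadical he v = mulRadical he w := by
  obtain ⟨c, hc⟩ := Submodule.mem_span_singleton.mp h
  rw [← sub_eq_zero, ← map_sub, ← hc, map_smul, mulRadical_self, smul_zero]

end Splitting

/-! ### Isometries between `V`, a complement and the quotient -/

section Complement

variable {F : Type*} [Field F] {V : Type*} [AddCommGroup V] [Module F V]
variable {B : LinearMap.BilinForm F V} {U W : Submodule F V}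

/-- `B v = B w` as functionals, so `B v v = B w v = B v w = B w w`. -/
lemma apply_self_eq_of_sub_mem_ker (hB : B.IsSymm) {v w : V} (h : v - w ∈ LinearMap.ker B) :
    B v v = B w w := by
  rw [LinearMap.mem_ker, map_sub, sub_eq_zero] at h
  rw [h, ← hB.eq v w, h]

lemma sub_projectionOnto_mem (hW : IsCompl W U) (v : V) :
    v - W.projectionOnto U hW v ∈ U := by
  rw [← Submodule.projectionOnto_apply_eq_zero_iff hW, map_sub,
    Submodule.projectionOnto_apply_left, sub_self]

/-- The projection along a radical subspace onto a complement, an isometry. -/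
def complementProjection (hB : B.IsSymm) (hU : U ≤ LinearMap.ker B) (hW : IsCompl W U) :
    quad B →qᵢ quad (B.restrict W) where
  toLinearMap := W.projectionOnto U hW
  map_app' v := (apply_self_eq_of_sub_mem_ker hB (hU (sub_projectionOnto_mem hW v))).symm

/-- The isometry from the quotient by a radical subspace onto a complement. -/
def quotientSection (hB : B.IsSymm) (hU : U ≤ LinearMap.ker B) (hW : IsCompl W U) :
    quad (quotientForm B hB U hU) →qᵢ quad B where
  toLinearMap := W.subtype ∘ₗ (U.quotientEquivOfIsCompl W hW.symm).toLinearMap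
  map_app' v := by
    obtain ⟨v, rfl⟩ := U.mkQ_surjective v
    exact (apply_self_eq_of_sub_mem_ker hB (hU (sub_projectionOnto_mem hW v))).symm

lemma quotientSection_mk (hB : B.IsSymm) (hU : U ≤ LinearMap.ker B) (hW : IsCompl W U) (v : V) :
    quotientSection hB hU hW (U.mkQ v) = W.projectionOnto U hW v := rfl

lemma quotientSection_mk_coe (hB : B.IsSymm) (hU : U ≤ LinearMap.ker B) (hW : IsCompl W U) (w : W) :
    quotientSection hB hU hW (U.mkQ w) = w := by
  rw [quotientSection_mk, Submodule.projectionOnto_apply_left]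

lemma projection_quotientSection (hB : B.IsSymm) (hU : U ≤ LinearMap.ker B) (hW : IsCompl W U) :
    Function.LeftInverse (projection B hB U hU) (quotientSection hB hU hW) :=
  fun v => Submodule.mk_quotientEquivOfIsCompl_apply hW.symm v

end Complement

end PGA

end

/-! ### The two semidirect decompositions -/

open CliffordAlgebra LieAlgebra in
theorem mainTheorem4 {F : Type*} [Field F] [Invertible (2 : F)]
    {V : Type*} [AddCommGroup V] [Module F V]
    (B : LinearMap.BilinForm F V) (hB : B.IsSymm)
    (e₀ : V) (he₀ : e₀ ≠ 0) (hrad : Submodule.span F {e₀} ≤ LinearMap.ker B)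
    (W : Submodule F V) (hW : IsCompl W (Submodule.span F {e₀})) :
    -- `Cl²(V)` is the internal semidirect sum of the subalgebra `Cl²(W)` and the
    -- abelian ideal `W e₀`
    (Function.Injective (PGA.bivectorMap (PGA.inclusion B W)) ∧
      ∃ I : LieIdeal F (PGA.Bivector (PGA.quad B)),
        Subtype.val '' (I : Set (PGA.Bivector (PGA.quad B))) =
          {x | ∃ w ∈ W, x = ι (PGA.quad B) w * ι (PGA.quad B) e₀} ∧
        IsLieAbelian I ∧
        IsCompl (PGA.bivectorMap (PGA.inclusion B W)).range.toSubmodule I.toSubmodule) ∧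
    -- `Cl²(V) ≅ Cl²(W) ⋉_τ W`
    (∃ φ : PGA.Bivector (PGA.quad B) ≃ₗ⁅F⁆
        (PGA.AbelianLie W ⋊⁅PGA.tau (PGA.quad (B.restrict W))⁆
          PGA.Bivector (PGA.quad (B.restrict W))),
      (∀ b, φ (PGA.bivectorMap (PGA.inclusion B W) b) = SemiDirectSum.inr _ b) ∧
      ∀ (w : W) (x : PGA.Bivector (PGA.quad B)),
        x.1 = ι (PGA.quad B) (w : V) * ι (PGA.quad B) e₀ →
          φ x = SemiDirectSum.inl _ (PGA.AbelianLie.of F w)) ∧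
    -- `Cl²(V) ≅ Cl²(V/Fe₀) ⋉_τ' V/Fe₀`
    (∃ φ' : PGA.Bivector (PGA.quad B) ≃ₗ⁅F⁆
        (PGA.AbelianLie (V ⧸ Submodule.span F {e₀})
          ⋊⁅PGA.tau (PGA.quad (PGA.quotientForm B hB (Submodule.span F {e₀}) hrad))⁆
          PGA.Bivector (PGA.quad (PGA.quotientForm B hB (Submodule.span F {e₀}) hrad))),
      (∀ b, φ' (PGA.bivectorMap (PGA.inclusion B W) b) = SemiDirectSum.inr _
        (PGA.bivectorMap (PGA.projection B hB (Submodule.span F {e₀}) hrad)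
          (PGA.bivectorMap (PGA.inclusion B W) b))) ∧
      ∀ (w : W) (x : PGA.Bivector (PGA.quad B)),
        x.1 = ι (PGA.quad B) (w : V) * ι (PGA.quad B) e₀ →
          φ' x = SemiDirectSum.inl _
            (PGA.AbelianLie.of F (Submodule.Quotient.mk (w : V)))) := by
  have he : ∀ v, QuadraticMap.polar (PGA.quad B) v e₀ = 0 := fun v => by
    have h : B e₀ = 0 := hrad (Submodule.mem_span_singleton_self e₀)
    rw [LinearMap.BilinMap.polar_toQuadraticMap, ← hB.eq e₀ v, h]
    simp
  have hr : PGA.complementProjection hB hrad hW e₀ = 0 :=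
    (Submodule.projectionOnto_apply_eq_zero_iff hW).mpr (Submodule.mem_span_singleton_self e₀)
  have hinv : Function.LeftInverse (PGA.complementProjection hB hrad hW) (PGA.inclusion B W) :=
    Submodule.projectionOnto_apply_left hW
  have hs : ∀ v, ∃ w, v - PGA.inclusion B W w ∈ Submodule.span F {e₀} :=
    fun v => ⟨_, PGA.sub_projectionOnto_mem hW v⟩
  have hr' : PGA.projection B hB (Submodule.span F {e₀}) hrad e₀ = 0 :=
    (Submodule.Quotient.mk_eq_zero _).mpr (Submodule.mem_span_singleton_self e₀)
  have hinv' := PGA.projection_quotientSection hB hrad hW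
  have hs' : ∀ v, ∃ w, v - PGA.quotientSection hB hrad hW w ∈ Submodule.span F {e₀} :=
    fun v => ⟨Submodule.mkQ _ v, PGA.sub_projectionOnto_mem hW v⟩
  refine ⟨⟨(PGA.bivectorMap_leftInverse hinv).injective, PGA.radicalIdeal he, ?_,
    PGA.isLieAbelian_radicalIdeal he, PGA.isCompl_range_bivectorMap_radicalIdeal he hinv hr hs⟩,
    ⟨PGA.semiDirectEquiv he he₀ hinv hr hs, PGA.semiDirectEquiv_bivectorMap he he₀ hinv hr hs, ?_⟩,
    ⟨PGA.semiDirectEquiv he he₀ hinv' hr' hs', ?_, ?_⟩⟩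
  · ext x
    constructor
    · rintro ⟨_, ⟨v, rfl⟩, rfl⟩
      obtain ⟨w, hw⟩ := hs v
      exact ⟨w, w.2, congrArg Subtype.val (PGA.mulRadical_eq_of_sub_mem he hw)⟩
    · rintro ⟨w, -, rfl⟩
      exact ⟨_, ⟨w, rfl⟩, PGA.coe_mulRadical he w⟩
  · intro w x hx
    obtain rfl : x = PGA.mulRadical he w := Subtype.ext hx
    exact PGA.semiDirectEquiv_mulRadical he he₀ hinv hr hs w
  · intro b
    -- It suffices that section ∘ projection ∘ inclusion is the inclusion of `W`, since the section
    -- inverts the projection on `W`.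
    rw [← PGA.semiDirectEquiv_bivectorMap he he₀ hinv' hr' hs', PGA.bivectorMap_comp,
      PGA.bivectorMap_comp]
    congr 3
    ext w
    exact (PGA.quotientSection_mk_coe hB hrad hW w).symm
  · intro w x hx
    obtain rfl : x = PGA.mulRadical he w := Subtype.ext hx
    -- Writing `w` as the section of its class makes `semiDirectEquiv_mulRadical` applicable.
    conv_lhs => rw [← PGA.quotientSection_mk_coe hB hrad hW w]
    exact PGA.semiDirectEquiv_mulRadical he he₀ hinv' hr' hs' _
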